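/- Let $E$ be a countable set and let $r(x,y)\ge 0$, $x\neq y\in E$, be jump rates with $\lambda(x)=\sum_{y\ne x} r(x,y)<\infty$ for every $x\in E$. Let $\{X_t : t\ge 0\}$ be the (minimal) continuous-time Markov chain on $E$ which waits at $x$ an exponential time of parameter $\lambda(x)$ and then jumps to $y$ with probability $r(x,y)/\lambda(x)$; a state with $\lambda(x)=0$ is absorbing. Assume that the chain is irreducible, and that it admits a stationary measure $\mu$, that is, a function $\mu:E\to[0,\infty)$, not identically zero, such that $\sum_{x\neq y}\mu(x)\,r(x,y)=\mu(y)\,\lambda(y)$ for every $y\in E$. Let $r^*$ be the rates of the time-reversed chain, given by $\mu(x)\,r^*(x,y)=\mu(y)\,r(y,x)$, and let $\{X^s_t : t\ge 0\}$ be the reversible version of the chain, that is, the (minimal) Markov chain with jump rates $\tfrac12\{r(x,y)+r^*(x,y)\}$, whose generator is $S=\tfrac12(L+L^*)$, where $L$ and $L^*$ are the generators associated to $r$ and $r^*$. For $x\ne y$ set $$c_s(x,y)=\tfrac12\{\mu(x)r(x,y)+\mu(y)r(y,x)\},\qquad c_a(x,y)=\tfrac12\{\mu(x)r(x,y)-\mu(y)r(y,x)\},$$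 and let $\mathcal E=\{(x,y)\in E\times E : x\neq y,\ c_s(x,y)>0\}$. A chain is called recurrent if, started at any state $x$, it almost surely visits $x$ at arbitrarily large times. If the chain $\{X^s_t : t\ge 0\}$ is recurrent and $$\sum_{(x,y)\in\mathcal E}\frac{c_a(x,y)^2}{c_s(x,y)}<\infty,$$ then the chain $\{X_t : t\ge 0\}$ is recurrent. -/

import Mathlib

open MeasureTheory ProbabilityTheory
open scoped ENNReal NNReal

/-- Jump rates `r(x,y) = λ(x) p(x,y)` of a continuous-time Markov chain on `E`: nonnegative, no
self-jumps, and finite total rate out of every state. -/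
structure JumpRates (E : Type*) where
  /-- The rate of jumping from the first state to the second. -/
  rate : E → E → ℝ≥0
  rate_self : ∀ x, rate x x = 0
  summable_rate : ∀ x, Summable (rate x)

namespace JumpRates

variable {E : Type*}

noncomputable section

/-- The holding rate `λ(x) = ∑_y r(x,y)`. -/
def holdingRate (Q : JumpRates E) (x : E) : ℝ≥0 := ∑' y, Q.rate x y

/-- Any state can be reached from any state through jumps of positive rate. -/
def Irreducible (Q : JumpRates E) : Prop :=
  ∀ x y, Relation.ReflTransGen (fun a b => 0 < Q.rate a b) x y

/-- `μ` is a stationary measure: it is finite at each point (possibly of infinite total mass), not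
identically zero, and `∑_x μ(x) r(x,y) = μ(y) λ(y)` for every `y`. -/
structure IsStationary (Q : JumpRates E) (μ : E → ℝ≥0) : Prop where
  ne_zero : μ ≠ 0
  balance : ∀ y, HasSum (fun x => μ x * Q.rate x y) (μ y * Q.holdingRate y)

/-! ### The continuous-time process -/

open Classical in
/-- The law `p(x,·)` of the next state of the jump chain: `r(x,·)/λ(x)` if `λ(x) > 0`; a state with
`λ(x) = 0` is absorbing. -/
def jumpPMF (Q : JumpRates E) (x : E) : PMF E :=
  if h : ∑' y, (Q.rate x y : ℝ≥0∞) = 0 then PMF.pure x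
  else PMF.normalize (fun y => (Q.rate x y : ℝ≥0∞)) h
    (ENNReal.tsum_coe_ne_top_iff_summable.mpr (Q.summable_rate x))

/-- The transition kernel of the jump chain. -/
def jumpKernel [MeasurableSpace E] [DiscreteMeasurableSpace E] (Q : JumpRates E) :
    Kernel E E where
  toFun x := (Q.jumpPMF x).toMeasure
  measurable' := Measurable.of_discrete

instance [MeasurableSpace E] [DiscreteMeasurableSpace E] (Q : JumpRates E) :
    IsMarkovKernel Q.jumpKernel :=
  ⟨fun x => PMF.toMeasure.isProbabilityMeasure (Q.jumpPMF x)⟩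

/-- The law of the discrete-time jump chain `(Y_n)` started at `x`. -/
def jumpChainLaw [MeasurableSpace E] [DiscreteMeasurableSpace E] (Q : JumpRates E) (x : E) :
    Measure (ℕ → E) :=
  Kernel.traj (X := fun _ => E)
    (fun n => Q.jumpKernel.comap (fun h => h ⟨n, Finset.mem_Iic.mpr le_rfl⟩)
      (measurable_pi_apply _)) 0 (fun _ => x)

instance isProbabilityMeasure_expMeasure_one : IsProbabilityMeasure (expMeasure 1) :=
  isProbabilityMeasure_expMeasure one_pos

/-- The law `P_x` of the pair formed by the jump chain started at `x` and an independent sequence of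
independent exponential variables of parameter one, from which the process is built. -/
def law [MeasurableSpace E] [DiscreteMeasurableSpace E] (Q : JumpRates E) (x : E) :
    Measure ((ℕ → E) × (ℕ → ℝ)) :=
  (Q.jumpChainLaw x).prod (Measure.infinitePi (fun _ : ℕ => expMeasure 1))

/-- The time spent in the `n`-th state `Y_n`: exponential of parameter `λ(Y_n)` given the jump
chain, and infinite if `λ(Y_n) = 0`. -/
def holdingTime (Q : JumpRates E) (ω : (ℕ → E) × (ℕ → ℝ)) (n : ℕ) : ℝ≥0∞ :=
  ENNReal.ofReal (ω.2 n) / (Q.holdingRate (ω.1 n) : ℝ≥0∞)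

/-- The time of the `n`-th jump, with `jumpTime 0 = 0`. -/
def jumpTime (Q : JumpRates E) (ω : (ℕ → E) × (ℕ → ℝ)) (n : ℕ) : ℝ≥0∞ :=
  ∑ k ∈ Finset.range n, Q.holdingTime ω k

open Classical in
/-- The process `X_t`: it is equal to `Y_n` at the times `t` from the `n`-th jump time (included) to
the next one (excluded), and to a cemetery state `none` from the explosion time on, if there is
one. -/
def process (Q : JumpRates E) (t : ℝ≥0) (ω : (ℕ → E) × (ℕ → ℝ)) : Option E :=
  if h : ∃ n, (t : ℝ≥0∞) < Q.jumpTime ω (n + 1) then some (ω.1 (Nat.find h)) else none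

/-- The process is recurrent: started at any state `x`, it almost surely visits `x` at arbitrarily
large times. -/
def Recurrent [MeasurableSpace E] [DiscreteMeasurableSpace E] (Q : JumpRates E) : Prop :=
  ∀ x, ∀ᵐ ω ∂(Q.law x), ¬ BddAbove {t : ℝ≥0 | Q.process t ω = some x}

/-! ### The reversed and the symmetrized process -/

/-- The rates `r*` of the time-reversed process (generator `L*`, the adjoint of `L` in `L²(μ)`),
given by `μ(x) r*(x,y) = μ(y) r(y,x)`. -/
def adjoint (Q : JumpRates E) (μ : E → ℝ≥0) (h : Q.IsStationary μ) : JumpRates E where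
  rate x y := μ y * Q.rate y x / μ x
  rate_self x := by simp [Q.rate_self x]
  summable_rate x := (h.balance x).summable.div_const (μ x)

/-- The rates `(r + r*)/2` of the reversible version of the process, whose generator is
`S = (L + L*)/2`. -/
def symmetrization (Q : JumpRates E) (μ : E → ℝ≥0) (h : Q.IsStationary μ) : JumpRates E where
  rate x y := (Q.rate x y + (Q.adjoint μ h).rate x y) / 2
  rate_self x := by simp [Q.rate_self x, (Q.adjoint μ h).rate_self x]
  summable_rate x :=
    ((Q.summable_rate x).add ((Q.adjoint μ h).summable_rate x)).div_const 2

/-- The conductances `c(x,y) = μ(x) r(x,y)`. -/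
def conductance (Q : JumpRates E) (μ : E → ℝ≥0) (x y : E) : ℝ := μ x * Q.rate x y

/-- The symmetric conductances `c_s = (c + c*)/2`, where `c*(x,y) = μ(x) r*(x,y)`. -/
def symmConductance (Q : JumpRates E) (μ : E → ℝ≥0) (h : Q.IsStationary μ) (x y : E) : ℝ :=
  (1 / 2) * (Q.conductance μ x y + (Q.adjoint μ h).conductance μ x y)

/-- The asymmetric conductances `c_a = (c - c*)/2`, where `c*(x,y) = μ(x) r*(x,y)`. -/
def asymmConductance (Q : JumpRates E) (μ : E → ℝ≥0) (h : Q.IsStationary μ) (x y : E) : ℝ :=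
  (1 / 2) * (Q.conductance μ x y - (Q.adjoint μ h).conductance μ x y)

/-- The set of oriented edges `{(x,y) : c_s(x,y) > 0}`. -/
def edges (Q : JumpRates E) (μ : E → ℝ≥0) (h : Q.IsStationary μ) : Set (E × E) :=
  {e | 0 < Q.symmConductance μ h e.1 e.2}

end

end JumpRates

/-! When no state is absorbing, recurrence of each process amounts to recurrence of its jump chain,
hence to divergence of the Green function `∑ pⁿ(z,z)`; an absorbing state forces `E` to be a single
point. So two discrete chains are compared. With `M = μ λ`, the conductances `c(x,y) = μ(x) r(x,y)`
have all row and column sums equal to `M`, and the symmetrized chain has the same `M`, with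
conductances `a = c_s`.

If the symmetrized Green function diverges, its discounted resolvents, normalized at `z`, give test
functions `0 ≤ h ≤ 1` with `h z = 1` and arbitrarily small energy `A = ∑ a (h x - h y)²`
(`exists_test_function`). Connectedness makes a sequence of these tend to `1` pointwise.

Let `g` be the resolvent at `z` of the original chain, with discount `s`. Pairing its equation with
`h` and removing `∑ c(x,y) (g x - g y)`, which vanishes by stationarity, gives `M z = (1-s) ∑ M h g
+ s ∑ c(x,y) (h x - 1) (g x - g y)`. Averaged over `x ↔ y`, the last sum pairs `g x - g y` with `a
(h x - h y) + b (h x + h y - 2)`, where `b = c_a`. Young's inequality bounds it by `A`, by `W = ∑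
b²/a (2 - h x - h y)²` and by the energy of `g`, itself at most a multiple of `g z`
(`IsResolvent.energy_le`). Since `∑ b²/a < ∞`, dominated convergence sends `W` to `0`. Were the
Green function at `z` finite, `g z` would stay bounded as `s → 1` and the right-hand side could be
made smaller than `M z`. -/

section Conductances

/-! ### Energy estimates for resolvents of non-symmetric conductances. -/

variable {E : Type*} {c : E → E → ℝ} {M : E → ℝ}

lemma hasSum_conductance_mul_fst (hc : ∀ x y, 0 ≤ c x y) (hrow : ∀ x, HasSum (c x) (M x))
    {φ : E → ℝ} (hφ : Summable fun x => M x * φ x) :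
    HasSum (fun e : E × E => c e.1 e.2 * φ e.1) (∑' x, M x * φ x) := by
  have hM : ∀ x, 0 ≤ M x := fun x => (hrow x).nonneg (hc x)
  have hs : Summable (fun e : E × E => c e.1 e.2 * φ e.1) := by
    refine Summable.of_norm ?_
    rw [summable_prod_of_nonneg (fun _ => norm_nonneg _)]
    have h1 : ∀ x, HasSum (fun y => ‖c x y * φ x‖) (M x * |φ x|) := fun x => by
      simpa [abs_mul, abs_of_nonneg (hc x _)] using (hrow x).mul_right |φ x|
    refine ⟨fun x => (h1 x).summable, ?_⟩
    simp_rw [(h1 _).tsum_eq]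
    simpa [abs_mul, abs_of_nonneg (hM _)] using hφ.abs
  have h2 := hs.hasSum
  rwa [hs.tsum_prod' (fun x => ((hrow x).mul_right (φ x)).summable),
    tsum_congr fun x => ((hrow x).mul_right (φ x)).tsum_eq] at h2

lemma hasSum_conductance_mul_snd (hc : ∀ x y, 0 ≤ c x y)
    (hcol : ∀ y, HasSum (fun x => c x y) (M y))
    {φ : E → ℝ} (hφ : Summable fun x => M x * φ x) :
    HasSum (fun e : E × E => c e.1 e.2 * φ e.2) (∑' x, M x * φ x) :=
  (Equiv.prodComm E E).hasSum_iff.mp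
    (hasSum_conductance_mul_fst (c := fun x y => c y x) (fun x y => hc y x) hcol hφ)

lemma summable_conductance_mul_mul (hc : ∀ x y, 0 ≤ c x y)
    (hcol : ∀ y, HasSum (fun x => c x y) (M y))
    {φ ψ : E → ℝ} {B : ℝ} (hψ : ∀ x, |ψ x| ≤ B) (hφ : Summable fun x => M x * φ x) :
    Summable (fun e : E × E => c e.1 e.2 * (ψ e.1 * φ e.2)) := by
  refine Summable.of_norm_bounded
    ((hasSum_conductance_mul_snd hc hcol hφ).summable.abs.mul_left B) fun e => ?_
  rw [Real.norm_eq_abs, mul_left_comm, abs_mul]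
  exact mul_le_mul_of_nonneg_right (hψ _) (abs_nonneg _)

lemma summable_mul_mul_of_abs_le {φ ψ : E → ℝ} {B : ℝ} (hψ : ∀ x, |ψ x| ≤ B)
    (hφ : Summable fun x => M x * φ x) : Summable fun x => M x * (ψ x * φ x) := by
  refine Summable.of_norm_bounded (hφ.abs.mul_left B) fun x => ?_
  rw [Real.norm_eq_abs, mul_left_comm, abs_mul]
  exact mul_le_mul_of_nonneg_right (hψ _) (abs_nonneg _)

/-- `g` solves the resolvent equation `(1 - s P) g = 1_{z}` for the kernel `P = c / M`. -/
structure IsResolvent (c : E → E → ℝ) (M : E → ℝ) (s : ℝ) (z : E) (g : E → ℝ) : Prop where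
  nonneg : ∀ x, 0 ≤ g x
  le : ∀ x, g x ≤ g z
  summable : Summable fun x => M x * g x
  eq_zero : ∀ x, x ≠ z → M x * g x - s * ∑' y, c x y * g y = 0
  eq_self : M z * g z - s * ∑' y, c z y * g y = M z

namespace IsResolvent

variable {s : ℝ} {z : E} {g : E → ℝ}

lemma abs_le (hg : IsResolvent c M s z g) (x : E) : |g x| ≤ g z := by
  rw [abs_of_nonneg (hg.nonneg x)]; exact hg.le x

/-- Multiply the resolvent equation by `h` and sum over `x`: only the term at `z` survives. The
column sums of `c` and the `M`-summability of `g` make the double series converge absolutely. -/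
lemma pairing (hg : IsResolvent c M s z g) (hc : ∀ x y, 0 ≤ c x y)
    (hcol : ∀ y, HasSum (fun x => c x y) (M y))
    {h : E → ℝ} {B : ℝ} (hh : ∀ x, |h x| ≤ B) :
    M z * h z = ∑' x, M x * (h x * g x)
      - s * ∑' e : E × E, c e.1 e.2 * (h e.1 * g e.2) := by
  have hs := summable_conductance_mul_mul hc hcol hh hg.summable
  have h1 := hs.prod
  have h2 := hs.tsum_prod
  rw [h2, ← tsum_mul_left, ← (summable_mul_mul_of_abs_le hh hg.summable).tsum_sub (h1.mul_left s),
    tsum_eq_single z]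
  · have : ∀ y, c z y * (h z * g y) = h z * (c z y * g y) := fun y => by ring
    simp_rw [this, tsum_mul_left]
    linear_combination (-h z) * hg.eq_self
  · intro x hx
    have : ∀ y, c x y * (h x * g y) = h x * (c x y * g y) := fun y => by ring
    simp_rw [this, tsum_mul_left]
    linear_combination (h x) * hg.eq_zero x hx

lemma hasSum_sq_sub (hg : IsResolvent c M s z g) (hc : ∀ x y, 0 ≤ c x y)
    (hrow : ∀ x, HasSum (c x) (M x)) (hcol : ∀ y, HasSum (fun x => c x y) (M y)) :
    HasSum (fun e : E × E => c e.1 e.2 * (g e.1 - g e.2) ^ 2)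
      (2 * ∑' x, M x * (g x * g x) - 2 * ∑' e : E × E, c e.1 e.2 * (g e.1 * g e.2)) := by
  have hsq := summable_mul_mul_of_abs_le hg.abs_le hg.summable
  have h1 := hasSum_conductance_mul_fst hc hrow hsq
  have h2 := hasSum_conductance_mul_snd hc hcol hsq
  have h3 := (summable_conductance_mul_mul hc hcol hg.abs_le hg.summable).hasSum.mul_left 2
  rw [two_mul (∑' x, M x * (g x * g x))]
  have h := (h1.add h2).sub h3
  refine (congrArg (HasSum · _) (funext fun e => ?_)).mp h
  ring

/-- Pairing the equation with `g` itself shows that the two sides differ by exactly `2 (1 - s) ∑ M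
g²`. -/
lemma energy_le (hg : IsResolvent c M s z g) (hc : ∀ x y, 0 ≤ c x y)
    (hrow : ∀ x, HasSum (c x) (M x)) (hcol : ∀ y, HasSum (fun x => c x y) (M y)) (hs : s ≤ 1) :
    s * ∑' e : E × E, c e.1 e.2 * (g e.1 - g e.2) ^ 2 ≤ 2 * (M z * g z) := by
  rw [(hg.hasSum_sq_sub hc hrow hcol).tsum_eq]
  have hp := hg.pairing hc hcol hg.abs_le
  have h0 : 0 ≤ ∑' x, M x * (g x * g x) := tsum_nonneg fun x =>
    mul_nonneg ((hrow x).nonneg (hc x)) (mul_self_nonneg _)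
  nlinarith [mul_nonneg (sub_nonneg.mpr hs) h0]

/-- Testing the resolvent equation against `h`; stationarity allows to replace `h` by `h - 1` in
the gradient term. -/
lemma pairing_gradient (hg : IsResolvent c M s z g) (hc : ∀ x y, 0 ≤ c x y)
    (hrow : ∀ x, HasSum (c x) (M x)) (hcol : ∀ y, HasSum (fun x => c x y) (M y))
    {h : E → ℝ} {B : ℝ} (hh : ∀ x, |h x| ≤ B) :
    ∃ T, HasSum (fun e : E × E => c e.1 e.2 * ((h e.1 - 1) * (g e.1 - g e.2))) T ∧
      M z * h z = (1 - s) * ∑' x, M x * (h x * g x) + s * T := by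
  have h1 := hasSum_conductance_mul_fst hc hrow (summable_mul_mul_of_abs_le hh hg.summable)
  have h2 := (summable_conductance_mul_mul hc hcol hh hg.summable).hasSum
  have h3 := hasSum_conductance_mul_fst hc hrow hg.summable
  have h4 := hasSum_conductance_mul_snd hc hcol hg.summable
  have hp := hg.pairing hc hcol hh
  have h5 := ((h1.sub h2).sub h3).add h4
  refine ⟨_, (congrArg (HasSum · _) (funext fun e => ?_)).mp h5, ?_⟩
  · ring
  · rw [hp]; ring

end IsResolvent

lemma weighted_young {a b u v w ε : ℝ} (ha : 0 ≤ a) (hab : |b| ≤ a) (hε : 0 < ε) :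
    (1 / 2) * (a * u * v + b * w * v) ≤
      1 / (4 * ε) * (a * u ^ 2 + b ^ 2 / a * w ^ 2) + ε / 2 * (a * v ^ 2) := by
  -- For `a = 0` also `b = 0`, so everything vanishes; otherwise the difference of the two sides is
  -- a sum of two squares.
  rcases ha.eq_or_lt with rfl | ha
  · have : b = 0 := by simpa using hab
    simp [this]
  · have : 1 / (4 * ε) * (a * u ^ 2 + b ^ 2 / a * w ^ 2) + ε / 2 * (a * v ^ 2) -
        (1 / 2) * (a * u * v + b * w * v) =
        1 / (4 * ε) * a * ((u - ε * v) ^ 2 + (b / a * w - ε * v) ^ 2) := by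
      field_simp; ring
    have h2 : 0 ≤ 1 / (4 * ε) * a * ((u - ε * v) ^ 2 + (b / a * w - ε * v) ^ 2) := by positivity
    linarith

/-- The resolvent at `z` of a chain with conductances `c` controls, and is controlled by, the
symmetric energy of any test function `h` together with the asymmetric part of `c` where `h ≠ 1`. -/
lemma IsResolvent.le_of_test {s : ℝ} {z : E} {g : E → ℝ} (hg : IsResolvent c M s z g)
    (hc : ∀ x y, 0 ≤ c x y)
    (hrow : ∀ x, HasSum (c x) (M x)) (hcol : ∀ y, HasSum (fun x => c x y) (M y))
    (hs0 : 0 ≤ s) (hs : s ≤ 1) {h : E → ℝ} (h0 : ∀ x, 0 ≤ h x) (h1 : ∀ x, h x ≤ 1) (hz : h z = 1)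
    (hMh : Summable fun x => M x * h x)
    {a b : E → E → ℝ} (ha : ∀ x y, a x y = (c x y + c y x) / 2)
    (hb : ∀ x y, b x y = (c x y - c y x) / 2)
    (hA : Summable fun e : E × E => a e.1 e.2 * (h e.1 - h e.2) ^ 2)
    (hW : Summable fun e : E × E => b e.1 e.2 ^ 2 / a e.1 e.2 * (2 - h e.1 - h e.2) ^ 2)
    {ε : ℝ} (hε : 0 < ε) :
    M z ≤ (1 - s) * (g z * ∑' x, M x * h x) +
      1 / (4 * ε) * (∑' e : E × E, a e.1 e.2 * (h e.1 - h e.2) ^ 2 +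
        ∑' e : E × E, b e.1 e.2 ^ 2 / a e.1 e.2 * (2 - h e.1 - h e.2) ^ 2) +
      ε * (M z * g z) := by
  have hh : ∀ x, |h x| ≤ 1 := fun x => by rw [abs_of_nonneg (h0 x)]; exact h1 x
  have hM : ∀ x, 0 ≤ M x := fun x => (hrow x).nonneg (hc x)
  obtain ⟨T, hT, hTeq⟩ := hg.pairing_gradient hc hrow hcol hh
  have hT' := (Equiv.prodComm E E).hasSum_iff.mpr hT
  have hD := (hg.hasSum_sq_sub hc hrow hcol).summable.hasSum
  have hD' := (Equiv.prodComm E E).hasSum_iff.mpr hD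
  have hDle := hg.energy_le hc hrow hcol hs
  set D := ∑' e : E × E, c e.1 e.2 * (g e.1 - g e.2) ^ 2
  set A := ∑' e : E × E, a e.1 e.2 * (h e.1 - h e.2) ^ 2
  set W := ∑' e : E × E, b e.1 e.2 ^ 2 / a e.1 e.2 * (2 - h e.1 - h e.2) ^ 2
  have hA0 : 0 ≤ A := tsum_nonneg fun e => by
    rw [ha]; have := hc e.1 e.2; have := hc e.2 e.1; positivity
  have hW0 : 0 ≤ W := tsum_nonneg fun e => by
    rw [ha]; have := hc e.1 e.2; have := hc e.2 e.1; positivity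
  have hTle : T ≤ 1 / (4 * ε) * (A + W) + ε / 2 * D := by
    -- Averaging over edge reversal splits `c` into `a + b` and its transpose into `a - b`; Young's
    -- inequality then applies edge by edge.
    have e1 := (hT.add hT').mul_left (1 / 2)
    have e2 := ((hA.hasSum.add hW.hasSum).mul_left (1 / (4 * ε))).add
      ((hD.add hD').mul_left (ε / 2 * (1 / 2)))
    have := hasSum_le (fun e => ?_) e1 e2
    · linarith
    · have hab : |b e.1 e.2| ≤ a e.1 e.2 := by
        rw [ha, hb, _root_.abs_le]; constructor <;> linarith [hc e.1 e.2, hc e.2 e.1]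
      have ha0 : 0 ≤ a e.1 e.2 := (abs_nonneg _).trans hab
      refine (le_of_eq ?_).trans ((weighted_young (u := h e.1 - h e.2) (v := g e.1 - g e.2)
        (w := h e.1 + h e.2 - 2) ha0 hab hε).trans (le_of_eq ?_))
      · simp only [Function.comp, Equiv.prodComm_apply, Prod.fst_swap, Prod.snd_swap, ha, hb]
        ring
      · simp only [Function.comp, Equiv.prodComm_apply, Prod.fst_swap, Prod.snd_swap]
        have : c e.1 e.2 + c e.2 e.1 = 2 * a e.1 e.2 := by rw [ha]; ring
        linear_combination (-(ε / 4) * (g e.1 - g e.2) ^ 2) * this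
  have hsum : ∑' x, M x * (h x * g x) ≤ g z * ∑' x, M x * h x := by
    rw [← tsum_mul_left]
    refine (summable_mul_mul_of_abs_le hh hg.summable).tsum_le_tsum (fun x => ?_)
      (hMh.mul_left _)
    have := mul_le_mul_of_nonneg_left (hg.le x) (mul_nonneg (hM x) (h0 x))
    linarith
  rw [hz, mul_one] at hTeq
  have hAW : 0 ≤ 1 / (4 * ε) * (A + W) := by positivity
  have e1 := mul_le_mul_of_nonneg_left hTle hs0
  have e2 := mul_le_mul_of_nonneg_left hsum (sub_nonneg.mpr hs)
  have e3 := mul_le_mul_of_nonneg_left hDle (half_pos hε).le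
  have e4 := mul_le_mul_of_nonneg_right hs hAW
  linarith

end Conductances

/-! ### Green functions and the comparison of the two discrete chains. -/

section Green

variable {E : Type*}

/-- The probability `pⁿ(x,z)` that the chain with transition probabilities `p` is at `z` after `n`
steps. -/
noncomputable def stepProb (p : E → PMF E) (z : E) : ℕ → E → ℝ≥0∞
  | 0 => Set.indicator {z} 1
  | n + 1 => fun x => ∑' y, p x y * stepProb p z n y

/-- The discounted Green function `∑ₙ sⁿ pⁿ(x,z)`. -/
noncomputable def green (p : E → PMF E) (z : E) (s : ℝ≥0∞) (x : E) : ℝ≥0∞ :=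
  ∑' n, s ^ n * stepProb p z n x

variable (p : E → PMF E) (z : E)

lemma stepProb_le_one (n : ℕ) (x : E) : stepProb p z n x ≤ 1 := by
  induction n generalizing x with
  | zero => exact Set.indicator_apply_le' (fun _ => le_rfl) (fun _ => zero_le_one)
  | succ n ih =>
    calc ∑' y, p x y * stepProb p z n y ≤ ∑' y, p x y :=
          ENNReal.tsum_le_tsum fun y => mul_le_of_le_one_right' (ih y)
      _ = 1 := (p x).tsum_coe

lemma green_eq (s : ℝ≥0∞) (x : E) :
    green p z s x = Set.indicator {z} 1 x + s * ∑' y, p x y * green p z s y := by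
  rw [green, tsum_eq_zero_add' ENNReal.summable]
  congr 1
  · simp [stepProb]
  · simp_rw [green, ← ENNReal.tsum_mul_left]
    rw [ENNReal.tsum_comm]
    refine tsum_congr fun n => ?_
    simp_rw [stepProb, ← ENNReal.tsum_mul_left]
    exact tsum_congr fun y => by ring

lemma green_le_inv (s : ℝ≥0∞) (x : E) : green p z s x ≤ (1 - s)⁻¹ := by
  rw [← ENNReal.tsum_geometric]
  exact ENNReal.tsum_le_tsum fun n => mul_le_of_le_one_right' (stepProb_le_one p z n x)

lemma green_ne_top {s : ℝ≥0∞} (hs : s < 1) (x : E) : green p z s x ≠ ⊤ :=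
  ne_top_of_le_ne_top (ENNReal.inv_ne_top.mpr (tsub_pos_of_lt hs).ne') (green_le_inv p z s x)

lemma green_le_tsum {s : ℝ≥0∞} (hs : s ≤ 1) (x : E) : green p z s x ≤ ∑' n, stepProb p z n x :=
  ENNReal.tsum_le_tsum fun n => mul_le_of_le_one_left' (pow_le_one' hs n)

lemma one_le_green_self (s : ℝ≥0∞) : 1 ≤ green p z s z := by
  rw [green_eq]; simp

/-- Maximum principle: away from `z` the Green function is at most `s` times its finite supremum, so
that supremum is governed by the value at `z`. -/
lemma green_le_self {s : ℝ≥0∞} (hs : s < 1) (x : E) : green p z s x ≤ green p z s z := by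
  set A := ⨆ x, green p z s x
  have hA : A ≠ ⊤ := ne_top_of_le_ne_top (ENNReal.inv_ne_top.mpr (tsub_pos_of_lt hs).ne') (iSup_le (green_le_inv p z s))
  have h1 : ∀ x, x ≠ z → green p z s x ≤ s * A := fun x hx => by
    rw [green_eq]
    simp only [Set.mem_singleton_iff, hx, not_false_eq_true, Set.indicator_of_notMem, zero_add]
    gcongr
    calc ∑' y, p x y * green p z s y ≤ ∑' y, p x y * A :=
          ENNReal.tsum_le_tsum fun y => by gcongr; exact le_iSup (green p z s) y
      _ = A := by rw [ENNReal.tsum_mul_right, (p x).tsum_coe, one_mul]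
  have h2 : A ≤ max (green p z s z) (s * A) := iSup_le fun x => by
    by_cases hx : x = z
    · exact hx ▸ le_max_left _ _
    · exact (h1 x hx).trans (le_max_right _ _)
  rcases le_max_iff.mp h2 with h | h
  · exact (le_iSup (green p z s) x).trans h
  · have : A = 0 := by
      by_contra h0
      have := ENNReal.mul_lt_mul_left h0 hA hs
      rw [one_mul] at this
      exact absurd h (not_le.mpr this)
    exact ((le_iSup (green p z s) x).trans this.le).trans zero_le

lemma tsum_mul_stepProb {M : E → ℝ≥0∞} (hM : ∀ y, ∑' x, M x * p x y = M y) (n : ℕ) :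
    ∑' x, M x * stepProb p z n x = M z := by
  induction n with
  | zero =>
    rw [tsum_eq_single z fun x hx => by simp [stepProb, hx]]
    simp [stepProb]
  | succ n ih =>
    simp_rw [stepProb, ← ENNReal.tsum_mul_left]
    rw [ENNReal.tsum_comm]
    simp_rw [← mul_assoc, ENNReal.tsum_mul_right, hM]
    exact ih

lemma tsum_mul_green {M : E → ℝ≥0∞} (hM : ∀ y, ∑' x, M x * p x y = M y) (s : ℝ≥0∞) :
    ∑' x, M x * green p z s x = (1 - s)⁻¹ * M z := by
  simp_rw [green, ← ENNReal.tsum_mul_left]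
  rw [ENNReal.tsum_comm, ← ENNReal.tsum_geometric, ← ENNReal.tsum_mul_right]
  refine tsum_congr fun n => ?_
  simp_rw [mul_left_comm (M _), ENNReal.tsum_mul_left, tsum_mul_stepProb p z hM]

lemma exists_lt_one_le_green (h : ∑' n, stepProb p z n z = ⊤) (K : ℝ) :
    ∃ s : ℝ, 1 / 2 < s ∧ s < 1 ∧ K ≤ (green p z (ENNReal.ofReal s) z).toReal := by
  -- The factor `2` absorbs the discount: `s` is taken so close to `1` that `s ^ N > 1 / 2`.
  obtain ⟨N, hN⟩ : ∃ N, ENNReal.ofReal (2 * K) < ∑ n ∈ Finset.range N, stepProb p z n z := by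
    have := ENNReal.tendsto_nat_tsum fun n => stepProb p z n z
    rw [h] at this
    exact (this.eventually_const_lt ENNReal.ofReal_lt_top).exists
  have hcont : Filter.Tendsto (fun s : ℝ => s ^ N) (nhdsWithin 1 (Set.Iio 1)) (nhds 1) := by
    have : ContinuousAt (fun s : ℝ => s ^ N) 1 := by fun_prop
    simpa [ContinuousAt] using this.tendsto.mono_left nhdsWithin_le_nhds
  have e1 := hcont.eventually_const_lt (show (1 / 2 : ℝ) < 1 by norm_num)
  have e2 : ∀ᶠ s : ℝ in nhdsWithin 1 (Set.Iio 1), 1 / 2 < s :=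
    (Filter.tendsto_id.mono_right nhdsWithin_le_nhds).eventually_const_lt (by norm_num)
  obtain ⟨s, ⟨hsN, hs2⟩, hs1⟩ := ((e1.and e2).and self_mem_nhdsWithin).exists
  refine ⟨s, hs2, hs1, ?_⟩
  have hs1' : ENNReal.ofReal s < 1 := by simpa using hs1
  rw [← ENNReal.ofReal_le_iff_le_toReal (green_ne_top p z hs1' z)]
  calc ENNReal.ofReal K = ENNReal.ofReal (1 / 2) * ENNReal.ofReal (2 * K) := by
        rw [← ENNReal.ofReal_mul (by norm_num)]; congr 1; ring
    _ ≤ ENNReal.ofReal s ^ N * ∑ n ∈ Finset.range N, stepProb p z n z := by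
        rw [← ENNReal.ofReal_pow (by linarith)]
        gcongr
    _ ≤ ∑ n ∈ Finset.range N, ENNReal.ofReal s ^ n * stepProb p z n z := by
        rw [Finset.mul_sum]
        refine Finset.sum_le_sum fun n hn => ?_
        gcongr ?_ * _
        exact pow_le_pow_right_of_le_one' hs1'.le (Finset.mem_range.mp hn).le
    _ ≤ _ := ENNReal.sum_le_tsum _

lemma PMF.hasSum_toReal (q : PMF E) : HasSum (fun x => (q x).toReal) 1 := by
  have := ENNReal.hasSum_toReal (f := q) (by rw [q.tsum_coe]; simp)
  simpa [← ENNReal.tsum_toReal_eq q.apply_ne_top, q.tsum_coe] using this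

variable {p} {c : E → E → ℝ} {M : E → ℝ}

lemma isResolvent_green (hM : ∀ x, 0 ≤ M x) (hc : ∀ x y, c x y = M x * (p x y).toReal)
    (hcol : ∀ y, HasSum (fun x => c x y) (M y)) {s : ℝ} (hs0 : 0 ≤ s) (hs1 : s < 1) :
    IsResolvent c M s z fun x => (green p z (ENNReal.ofReal s) x).toReal := by
  have hs1' : ENNReal.ofReal s < 1 := by simpa using hs1
  have hfin := green_ne_top p z hs1'
  have hcol' : ∀ y, ∑' x, ENNReal.ofReal (M x) * p x y = ENNReal.ofReal (M y) := fun y => by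
    rw [← (hcol y).tsum_eq, ENNReal.ofReal_tsum_of_nonneg _ (hcol y).summable]
    · refine tsum_congr fun x => ?_
      rw [hc, ENNReal.ofReal_mul (hM x), ENNReal.ofReal_toReal ((p x).apply_ne_top y)]
    · intro x
      rw [hc]
      exact mul_nonneg (hM x) ENNReal.toReal_nonneg
  have heq : ∀ x, M x * (green p z (ENNReal.ofReal s) x).toReal -
      s * ∑' y, c x y * (green p z (ENNReal.ofReal s) y).toReal =
      M x * (Set.indicator {z} 1 x : ℝ≥0∞).toReal := fun x => by
    have hsum : ∑' y, c x y * (green p z (ENNReal.ofReal s) y).toReal =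
        M x * (∑' y, p x y * green p z (ENNReal.ofReal s) y).toReal := by
      rw [ENNReal.tsum_toReal_eq fun y => ENNReal.mul_ne_top ((p x).apply_ne_top y) (hfin y),
        ← tsum_mul_left]
      exact tsum_congr fun y => by rw [hc, ENNReal.toReal_mul, mul_assoc]
    have h := hfin x
    rw [green_eq] at h
    rw [hsum, green_eq p z _ x, ENNReal.toReal_add (ENNReal.add_ne_top.mp h).1
      (ENNReal.add_ne_top.mp h).2, ENNReal.toReal_mul, ENNReal.toReal_ofReal hs0]
    ring
  refine ⟨fun x => ENNReal.toReal_nonneg,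
    fun x => ENNReal.toReal_mono (hfin z) (green_le_self p z hs1' x), ?_, ?_, ?_⟩
  · have : ∑' x, ENNReal.ofReal (M x) * green p z (ENNReal.ofReal s) x ≠ ⊤ := by
      rw [tsum_mul_green p z hcol']
      exact ENNReal.mul_ne_top (ENNReal.inv_ne_top.mpr (tsub_pos_of_lt hs1').ne') ENNReal.ofReal_ne_top
    refine (ENNReal.summable_toReal this).congr fun x => ?_
    rw [ENNReal.toReal_mul, ENNReal.toReal_ofReal (hM x)]
  · intro x hx
    rw [heq]; simp [hx]
  · rw [heq]; simp

/-- Take `h = g / g z` with `g` the discounted Green function. As `s > 1 / 2`, the energy of `g` is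
at most `4 M z g z`, so that of `h` is at most `4 M z / g z`, which is small when `g z` is large. -/
lemma exists_test_function (hM : ∀ x, 0 < M x) (hc : ∀ x y, c x y = M x * (p x y).toReal)
    (hcol : ∀ y, HasSum (fun x => c x y) (M y)) (h : ∑' n, stepProb p z n z = ⊤)
    {δ : ℝ} (hδ : 0 < δ) :
    ∃ h : E → ℝ, (∀ x, 0 ≤ h x) ∧ (∀ x, h x ≤ 1) ∧ h z = 1 ∧ (Summable fun x => M x * h x) ∧
      (Summable fun e : E × E => c e.1 e.2 * (h e.1 - h e.2) ^ 2) ∧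
      ∑' e : E × E, c e.1 e.2 * (h e.1 - h e.2) ^ 2 ≤ δ := by
  have hc0 : ∀ x y, 0 ≤ c x y := fun x y => by
    rw [hc]; exact mul_nonneg (hM x).le ENNReal.toReal_nonneg
  have hrow : ∀ x, HasSum (c x) (M x) := fun x => by
    have := (p x).hasSum_toReal.mul_left (M x)
    rw [mul_one] at this
    rwa [show c x = fun y => M x * (p x y).toReal from funext (hc x)]
  obtain ⟨s, hs2, hs1, hK⟩ := exists_lt_one_le_green p z h (4 * M z / δ)
  have hg := isResolvent_green z (fun x => (hM x).le) hc hcol (by linarith : 0 ≤ s) hs1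
  set g := fun x => (green p z (ENNReal.ofReal s) x).toReal
  change 4 * M z / δ ≤ g z at hK
  have hMz := hM z
  have hgz : 0 < g z := lt_of_lt_of_le (by positivity) hK
  have hE := (hg.hasSum_sq_sub hc0 hrow hcol).summable
  have hEle := hg.energy_le hc0 hrow hcol hs1.le
  have heq : ∀ e : E × E, c e.1 e.2 * (g e.1 / g z - g e.2 / g z) ^ 2 =
      (g z)⁻¹ ^ 2 * (c e.1 e.2 * (g e.1 - g e.2) ^ 2) := fun e => by
    field_simp
  refine ⟨fun x => g x / g z, fun x => div_nonneg (hg.nonneg x) hgz.le,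
    fun x => (div_le_one hgz).mpr (hg.le x), div_self hgz.ne', ?_, ?_, ?_⟩
  · simpa [mul_div_assoc] using hg.summable.div_const (g z)
  · simp_rw [heq]
    exact hE.mul_left _
  · simp_rw [heq]
    rw [tsum_mul_left]
    set D := ∑' e : E × E, c e.1 e.2 * (g e.1 - g e.2) ^ 2
    have hD0 : 0 ≤ D := tsum_nonneg fun e => mul_nonneg (hc0 _ _) (sq_nonneg _)
    have hD : D ≤ 4 * M z * g z := by nlinarith
    rw [div_le_iff₀ hδ] at hK
    rw [inv_pow, inv_mul_le_iff₀ (by positivity)]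
    nlinarith

/-- If the symmetrization `q` of `p` has infinite Green function and the asymmetric part of the
conductances is small, then `p` has infinite Green function. -/
theorem tsum_stepProb_eq_top_of_symm {q : E → PMF E} {a b : E → E → ℝ} (hM : ∀ x, 0 < M x)
    (hc : ∀ x y, c x y = M x * (p x y).toReal) (hcol : ∀ y, HasSum (fun x => c x y) (M y))
    (ha : ∀ x y, a x y = (c x y + c y x) / 2) (hb : ∀ x y, b x y = (c x y - c y x) / 2)
    (hq : ∀ x y, a x y = M x * (q x y).toReal)
    (hconn : ∀ x, Relation.ReflTransGen (fun x y => 0 < a x y) z x)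
    (hsum : Summable fun e : E × E => b e.1 e.2 ^ 2 / a e.1 e.2)
    (h : ∑' n, stepProb q z n z = ⊤) : ∑' n, stepProb p z n z = ⊤ := by
  have hc0 : ∀ x y, 0 ≤ c x y := fun x y => by
    rw [hc]; exact mul_nonneg (hM x).le ENNReal.toReal_nonneg
  have ha0 : ∀ x y, 0 ≤ a x y := fun x y => by
    rw [hq]; exact mul_nonneg (hM x).le ENNReal.toReal_nonneg
  have hrow : ∀ x, HasSum (c x) (M x) := fun x => by
    have := (p x).hasSum_toReal.mul_left (M x)
    rw [mul_one] at this
    rwa [show c x = fun y => M x * (p x y).toReal from funext (hc x)]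
  have hacol : ∀ y, HasSum (fun x => a x y) (M y) := fun y => by
    have := ((hcol y).add (hrow y)).div_const 2
    rw [add_self_div_two] at this
    simpa only [ha] using this
  choose! h h0 h1 hz hMh hA hAle using
    fun (k : ℕ) => exists_test_function z hM hq hacol h (δ := 1 / ((k : ℝ) + 1)) (by positivity)
  have hAlim : Filter.Tendsto (fun k => ∑' e : E × E, a e.1 e.2 * (h k e.1 - h k e.2) ^ 2)
      Filter.atTop (nhds 0) :=
    squeeze_zero (fun k => tsum_nonneg fun e => mul_nonneg (ha0 _ _) (sq_nonneg _)) hAle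
      tendsto_one_div_add_atTop_nhds_zero_nat
  -- Each edge's energy is at most the total, so increments over edges with `a > 0` vanish in the
  -- limit; the limit `1` propagates from `z` along paths.
  have hlim : ∀ x, Filter.Tendsto (fun k => h k x) Filter.atTop (nhds 1) := fun x => by
    induction hconn x with
    | refl => simp [hz]
    | @tail x y _ hxy ih =>
      have e1 : Filter.Tendsto (fun k => a x y * (h k x - h k y) ^ 2) Filter.atTop (nhds 0) :=
        squeeze_zero (fun k => mul_nonneg (ha0 _ _) (sq_nonneg _))
          (fun k => (hA k).le_tsum (x, y) fun e _ => mul_nonneg (ha0 _ _) (sq_nonneg _)) hAlim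
      have e2 : Filter.Tendsto (fun k => (h k x - h k y) ^ 2) Filter.atTop (nhds 0) := by
        simpa [← mul_assoc, inv_mul_cancel₀ hxy.ne'] using e1.const_mul (a x y)⁻¹
      have e3 : Filter.Tendsto (fun k => |h k x - h k y|) Filter.atTop (nhds 0) := by
        simpa [Real.sqrt_sq_eq_abs] using e2.sqrt
      have e4 := ih.sub ((tendsto_zero_iff_abs_tendsto_zero _).mpr e3)
      simpa using e4
  have hbound : ∀ k (e : E × E), ‖b e.1 e.2 ^ 2 / a e.1 e.2 * (2 - h k e.1 - h k e.2) ^ 2‖ ≤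
      4 * (b e.1 e.2 ^ 2 / a e.1 e.2) := fun k e => by
    have hw : 0 ≤ b e.1 e.2 ^ 2 / a e.1 e.2 := div_nonneg (sq_nonneg _) (ha0 _ _)
    rw [Real.norm_eq_abs, abs_of_nonneg (mul_nonneg hw (sq_nonneg _)), mul_comm]
    refine mul_le_mul_of_nonneg_right ?_ hw
    nlinarith [h0 k e.1, h0 k e.2, h1 k e.1, h1 k e.2]
  have hW : ∀ k, Summable fun e : E × E =>
      b e.1 e.2 ^ 2 / a e.1 e.2 * (2 - h k e.1 - h k e.2) ^ 2 := fun k =>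
    Summable.of_norm_bounded (hsum.mul_left 4) (hbound k)
  have hWlim : Filter.Tendsto (fun k => ∑' e : E × E,
      b e.1 e.2 ^ 2 / a e.1 e.2 * (2 - h k e.1 - h k e.2) ^ 2) Filter.atTop (nhds 0) := by
    have := tendsto_tsum_of_dominated_convergence (𝓕 := Filter.atTop)
      (f := fun k (e : E × E) => b e.1 e.2 ^ 2 / a e.1 e.2 * (2 - h k e.1 - h k e.2) ^ 2)
      (g := fun _ => 0) (hsum.mul_left 4) (fun e => ?_) (Filter.Eventually.of_forall hbound)
    · simpa using this
    · have := ((((hlim e.1).const_sub 2).sub (hlim e.2)).pow 2).const_mul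
        (b e.1 e.2 ^ 2 / a e.1 e.2)
      norm_num at this
      exact this
  by_contra htop
  set Γ := (∑' n, stepProb p z n z).toReal
  have hgΓ : ∀ s : ℝ, s < 1 → (green p z (ENNReal.ofReal s) z).toReal ≤ Γ := fun s hs =>
    ENNReal.toReal_mono htop (green_le_tsum p z (by simpa using hs.le) z)
  have hΓ : 1 ≤ Γ := by
    rw [← ENNReal.toReal_one]
    exact ENNReal.toReal_mono htop ((one_le_green_self p z 0).trans
      (green_le_tsum p z zero_le_one z))
  have hMz := hM z
  have hlim2 := (hAlim.add hWlim).const_mul Γ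
  rw [add_zero, mul_zero] at hlim2
  -- The order matters: `k` is fixed before `s → 1`, since no bound on `∑ M h k` uniform in `k` is
  -- available. With `ε = 1 / (4 Γ)` each of the three terms is at most `M z / 4`, a contradiction.
  obtain ⟨k, hk⟩ := (hlim2.eventually_lt_const (by positivity : 0 < M z / 4)).exists
  have hlim3 : Filter.Tendsto (fun s : ℝ => (1 - s) * (Γ * ∑' x, M x * h k x))
      (nhdsWithin 1 (Set.Iio 1)) (nhds 0) := by
    have : ContinuousAt (fun s : ℝ => (1 - s) * (Γ * ∑' x, M x * h k x)) 1 := by fun_prop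
    simpa [ContinuousAt] using this.tendsto.mono_left nhdsWithin_le_nhds
  have e2 : ∀ᶠ s : ℝ in nhdsWithin 1 (Set.Iio 1), 0 < s :=
    (Filter.tendsto_id.mono_right nhdsWithin_le_nhds).eventually_const_lt zero_lt_one
  obtain ⟨s, ⟨hs, hs0⟩, hs1⟩ := (((hlim3.eventually_lt_const
    (by positivity : 0 < M z / 4)).and e2).and self_mem_nhdsWithin).exists
  have hg := isResolvent_green z (fun x => (hM x).le) hc hcol hs0.le hs1
  have key := hg.le_of_test hc0 hrow hcol hs0.le hs1.le (h0 k) (h1 k) (hz k) (hMh k) ha hb (hA k)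
    (hW k) (ε := 1 / (4 * Γ)) (by positivity)
  have k1 : (1 - s) * ((green p z (ENNReal.ofReal s) z).toReal * ∑' x, M x * h k x) ≤
      (1 - s) * (Γ * ∑' x, M x * h k x) := by
    have hMh0 : 0 ≤ ∑' x, M x * h k x := tsum_nonneg fun x => mul_nonneg (hM x).le (h0 k x)
    have hs1' : 0 ≤ 1 - s := by linarith
    gcongr
    exact hgΓ s hs1
  have k2 : 1 / (4 * Γ) * (M z * (green p z (ENNReal.ofReal s) z).toReal) ≤ M z / 4 := by
    calc _ ≤ 1 / (4 * Γ) * (M z * Γ) := by gcongr; exact hgΓ s hs1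
      _ = M z / 4 := by field_simp
  have k3 : 1 / (4 * (1 / (4 * Γ))) = Γ := by field_simp
  rw [k3] at key
  linarith

end Green

/-! ### Jump-chain recurrence and divergence of its Green function. -/

section JumpChain

namespace JumpRates

variable {E : Type*} (Q : JumpRates E)

/-- The probability, started at a given state, that the jump chain does not visit `z` at any of the
times `1, …, k`. -/
noncomputable def avoidProb (z : E) : ℕ → E → ℝ≥0∞
  | 0 => 1
  | k + 1 => fun x => ∑' y, Q.jumpPMF x y * Set.indicator {z}ᶜ (avoidProb z k) y

lemma avoidProb_le_one (z : E) (k : ℕ) (x : E) : Q.avoidProb z k x ≤ 1 := by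
  induction k generalizing x with
  | zero => exact le_rfl
  | succ k ih =>
    calc Q.avoidProb z (k + 1) x ≤ ∑' y, Q.jumpPMF x y :=
          ENNReal.tsum_le_tsum fun y => mul_le_of_le_one_right'
            (Set.indicator_apply_le' (fun _ => ih y) (fun _ => zero_le_one))
      _ = 1 := (Q.jumpPMF x).tsum_coe

variable [MeasurableSpace E] [DiscreteMeasurableSpace E]

instance isProbabilityMeasure_jumpChainLaw (x : E) : IsProbabilityMeasure (Q.jumpChainLaw x) := by
  unfold jumpChainLaw; infer_instance

lemma ae_jumpChainLaw_zero (x : E) : ∀ᵐ ω ∂Q.jumpChainLaw x, ω 0 = x := by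
  have h := Kernel.traj_map_frestrictLe_apply (X := fun _ => E)
    (κ := fun n => Q.jumpKernel.comap (fun h => h ⟨n, Finset.mem_Iic.mpr le_rfl⟩)
      (measurable_pi_apply _)) 0 0 (fun _ => x)
  rw [Kernel.partialTraj_self, Kernel.id_apply] at h
  have h2 : ∀ᵐ y ∂(Q.jumpChainLaw x).map (Preorder.frestrictLe (π := fun _ => E) 0),
      y ⟨0, Finset.mem_Iic.mpr le_rfl⟩ = x := by
    rw [jumpChainLaw, h, ae_dirac_iff]
    exact (MeasurableSet.of_discrete (s := {x})).preimage (measurable_pi_apply _)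
  exact ae_of_ae_map (by fun_prop) h2

lemma measurableSet_apply_mem (n : ℕ) (A : Set E) : MeasurableSet {ω : ℕ → E | ω n ∈ A} :=
  (MeasurableSet.of_discrete (s := A)).preimage (measurable_pi_apply n)

variable [Countable E]

lemma lintegral_jumpKernel (x : E) (f : E → ℝ≥0∞) :
    ∫⁻ y, f y ∂Q.jumpKernel x = ∑' y, Q.jumpPMF x y * f y := by
  rw [lintegral_countable']
  refine tsum_congr fun y => ?_
  rw [mul_comm]
  congr 1
  exact (Q.jumpPMF x).toMeasure_apply_singleton y (MeasurableSet.singleton y)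

/-- The Markov property at time `n`, for functions of the trajectory up to time `n`. -/
lemma lintegral_jumpChainLaw_succ (x : E) (n : ℕ) {F : (Finset.Iic n → E) → ℝ≥0∞}
    (hF : Measurable F) (f : E → ℝ≥0∞) :
    ∫⁻ ω, F (Preorder.frestrictLe n ω) * f (ω (n + 1)) ∂Q.jumpChainLaw x =
      ∫⁻ ω, F (Preorder.frestrictLe n ω) * ∑' y, Q.jumpPMF (ω n) y * f y
        ∂Q.jumpChainLaw x := by
  have hf : Measurable f := Measurable.of_discrete
  have hG : Measurable fun q : (Finset.Iic n → E) × E => F q.1 * f q.2 :=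
    (hF.comp measurable_fst).mul (hf.comp measurable_snd)
  have h1 := Kernel.partialTraj_compProd_eq_map_traj (X := fun _ => E)
    (κ := fun n => Q.jumpKernel.comap (fun h => h ⟨n, Finset.mem_Iic.mpr le_rfl⟩)
      (measurable_pi_apply _)) (Nat.zero_le n) (x₀ := fun _ => x)
  have h2 := congrArg (fun ν => ∫⁻ q, F q.1 * f q.2 ∂ν) h1
  rw [lintegral_map hG (by fun_prop), Measure.lintegral_compProd hG,
    ← Kernel.traj_map_frestrictLe_apply] at h2
  simp_rw [lintegral_const_mul _ hf] at h2
  rw [lintegral_map ?_ (by fun_prop)] at h2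
  · simp only [Kernel.comap_apply, lintegral_jumpKernel] at h2
    exact h2.symm
  · simp only [Kernel.comap_apply]
    refine hF.mul ?_
    exact (Measurable.of_discrete (f := fun y => ∫⁻ a, f a ∂Q.jumpKernel y)).comp
      (measurable_pi_apply _)

/-- `stepProb` peels off the first step while the Markov property acts on the last one; letting `m`
vary reconciles the two in the induction. -/
lemma lintegral_jumpChainLaw_stepProb (x z : E) (n m : ℕ) :
    ∫⁻ ω, stepProb Q.jumpPMF z m (ω n) ∂Q.jumpChainLaw x = stepProb Q.jumpPMF z (m + n) x := by
  induction n generalizing m with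
  | zero =>
    rw [lintegral_congr_ae (g := fun _ => stepProb Q.jumpPMF z m x)]
    · simp
    · filter_upwards [Q.ae_jumpChainLaw_zero x] with ω hω
      rw [hω]
  | succ n ih =>
    have := Q.lintegral_jumpChainLaw_succ x n (F := 1) measurable_const (stepProb Q.jumpPMF z m)
    simp only [Pi.one_apply, one_mul] at this
    rw [this, show m + (n + 1) = m + 1 + n by ring, ← ih]
    rfl

lemma jumpChainLaw_eq_stepProb (x z : E) (n : ℕ) :
    Q.jumpChainLaw x {ω | ω n = z} = stepProb Q.jumpPMF z n x := by
  have h := Q.lintegral_jumpChainLaw_stepProb x z n 0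
  rw [zero_add] at h
  rw [← h, ← lintegral_indicator_one]
  · rfl
  · exact (MeasurableSet.of_discrete (s := {z})).preimage (measurable_pi_apply n)

lemma tsum_stepProb_eq_top {x : E} (h : ∀ᵐ ω ∂Q.jumpChainLaw x, ∃ᶠ n in Filter.atTop, ω n = x) :
    ∑' n, stepProb Q.jumpPMF x n x = ⊤ := by
  by_contra htop
  simp_rw [← jumpChainLaw_eq_stepProb] at htop
  have h0 := measure_setOfPred_frequently_eq_zero (p := fun n (ω : ℕ → E) => ω n = x) htop
  have : ∀ᵐ ω ∂Q.jumpChainLaw x, False := by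
    filter_upwards [h, measure_eq_zero_iff_ae_notMem.mp h0] with ω a b using b a
  rw [Filter.eventually_false_iff_eq_bot, ae_eq_bot] at this
  exact IsProbabilityMeasure.ne_zero _ this

lemma lintegral_avoidProb (x z : E) (k n : ℕ) {F : (Finset.Iic n → E) → ℝ≥0∞}
    (hF : Measurable F) :
    ∫⁻ ω, F (Preorder.frestrictLe n ω) * Q.avoidProb z k (ω n) ∂Q.jumpChainLaw x =
      ∫⁻ ω, F (Preorder.frestrictLe n ω) *
        Set.indicator {ω : ℕ → E | ∀ m, n < m → m ≤ n + k → ω m ≠ z} 1 ω ∂Q.jumpChainLaw x := by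
  classical
  induction k generalizing n with
  | zero =>
    congr 1 with ω
    rw [Set.indicator_of_mem (show ω ∈ {ω : ℕ → E | ∀ m, n < m → m ≤ n + 0 → ω m ≠ z} from
      fun m _ _ => by omega)]
    rfl
  | succ k ih =>
    -- Avoidance of `z` at time `n + 1` is absorbed into the functional of the past, so the
    -- induction hypothesis applies from time `n + 1`.
    have hF' : Measurable fun y : Finset.Iic (n + 1) → E =>
        F (Preorder.frestrictLe₂ (π := fun _ => E) n.le_succ y) *
          Set.indicator {z}ᶜ 1 (y ⟨n + 1, Finset.mem_Iic.mpr le_rfl⟩) := by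
      refine (hF.comp (by fun_prop)).mul ?_
      exact (Measurable.of_discrete (f := Set.indicator ({z}ᶜ : Set E) (1 : E → ℝ≥0∞))).comp
        (measurable_pi_apply _)
    refine (Q.lintegral_jumpChainLaw_succ x n hF
      (Set.indicator {z}ᶜ (Q.avoidProb z k))).symm.trans ?_
    convert ih (n + 1) hF' using 3 with ω ω
    · rw [mul_assoc]
      congr 1
      by_cases hω : ω (n + 1) = z <;> simp [hω]
    · rw [mul_assoc]
      congr 1
      have : (∀ m, n < m → m ≤ n + (k + 1) → ω m ≠ z) ↔
          ω (n + 1) ≠ z ∧ ∀ m, n + 1 < m → m ≤ n + 1 + k → ω m ≠ z := by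
        constructor
        · exact fun h => ⟨h _ (by omega) (by omega), fun m h1 h2 => h m (by omega) (by omega)⟩
        · rintro ⟨h, h'⟩ m h1 h2
          rcases (show m = n + 1 ∨ n + 1 < m by omega) with rfl | h3
          · exact h
          · exact h' m h3 (by omega)
      simp only [Set.indicator_apply, Set.mem_ofPred_eq, this, Set.mem_compl_iff,
        Set.mem_singleton_iff, Preorder.frestrictLe_apply, Pi.one_apply]
      by_cases h1 : ω (n + 1) = z <;> simp [h1]

lemma jumpChainLaw_lastVisit_le (x z : E) (k n : ℕ) :
    Q.jumpChainLaw x {ω | ω n = z ∧ ∀ m, n < m → m ≤ n + k → ω m ≠ z} =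
      stepProb Q.jumpPMF z n x * Q.avoidProb z k z := by
  classical
  have hF : Measurable fun y : Finset.Iic n → E =>
      Set.indicator ({z} : Set E) (1 : E → ℝ≥0∞) (y ⟨n, Finset.mem_Iic.mpr le_rfl⟩) :=
    (Measurable.of_discrete (f := Set.indicator ({z} : Set E) (1 : E → ℝ≥0∞))).comp
      (measurable_pi_apply _)
  have h := Q.lintegral_avoidProb x z k n hF
  have hm : MeasurableSet {ω : ℕ → E | ω n = z ∧ ∀ m, n < m → m ≤ n + k → ω m ≠ z} := by
    simp only [Set.ofPred_and, Set.ofPred_forall]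
    exact (measurableSet_apply_mem n {z}).inter <| MeasurableSet.iInter fun m =>
      MeasurableSet.iInter fun _ => MeasurableSet.iInter fun _ => measurableSet_apply_mem m {z}ᶜ
  have hm' : MeasurableSet {ω : ℕ → E | ω n = z} := measurableSet_apply_mem n {z}
  rw [← jumpChainLaw_eq_stepProb, ← lintegral_indicator_one hm, ← lintegral_indicator_one hm',
    ← lintegral_mul_const' _ _ (ne_top_of_le_ne_top ENNReal.one_ne_top (Q.avoidProb_le_one z k z))]
  refine Eq.trans ?_ (h.symm.trans ?_)
  · congr 1 with ω
    by_cases h1 : ω n = z <;> simp [h1, Set.indicator_apply]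
  · congr 1 with ω
    by_cases h1 : ω n = z <;> simp [h1]

/-- If the Green function is infinite, the jump chain returns infinitely often. -/
lemma ae_frequently_of_tsum_stepProb_eq_top {x : E} (h : ∑' n, stepProb Q.jumpPMF x n x = ⊤) :
    ∀ᵐ ω ∂Q.jumpChainLaw x, ∃ᶠ n in Filter.atTop, ω n = x := by
  set L : ℕ → Set (ℕ → E) := fun n => {ω | ω n = x ∧ ∀ m, n < m → ω m ≠ x}
  have hL : ∀ n, MeasurableSet (L n) := fun n => by
    simp only [L, Set.ofPred_and, Set.ofPred_forall]
    exact (measurableSet_apply_mem n {x}).inter <| MeasurableSet.iInter fun m =>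
      MeasurableSet.iInter fun _ => measurableSet_apply_mem m {x}ᶜ
  set q := ⨅ k, Q.avoidProb x k x
  have hlow : ∀ n, stepProb Q.jumpPMF x n x * q ≤ Q.jumpChainLaw x (L n) := fun n => by
    set A : ℕ → Set (ℕ → E) := fun k => {ω | ω n = x ∧ ∀ m, n < m → m ≤ n + k → ω m ≠ x}
    have hA : L n = ⋂ k, A k := by
      ext ω
      simp only [L, A, Set.mem_iInter, Set.mem_ofPred_eq]
      exact ⟨fun h k => ⟨h.1, fun m h1 _ => h.2 m h1⟩,
        fun h => ⟨(h 0).1, fun m h1 => (h m).2 m h1 (by omega)⟩⟩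
    have hanti : Antitone A := fun k l hkl ω hω =>
      ⟨hω.1, fun m h1 h2 => hω.2 m h1 (by omega)⟩
    have hAm : ∀ k, MeasurableSet (A k) := fun k => by
      simp only [A, Set.ofPred_and, Set.ofPred_forall]
      exact (measurableSet_apply_mem n {x}).inter <| MeasurableSet.iInter fun m =>
        MeasurableSet.iInter fun _ => MeasurableSet.iInter fun _ => measurableSet_apply_mem m {x}ᶜ
    rw [hA, hanti.measure_iInter (fun k => (hAm k).nullMeasurableSet) ⟨0, measure_ne_top _ _⟩]
    refine le_iInf fun k => ?_
    rw [jumpChainLaw_lastVisit_le]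
    gcongr
    exact iInf_le _ k
  have hdisj : Pairwise (Function.onFun Disjoint L) := by
    intro i j hij
    rw [Function.onFun, Set.disjoint_left]
    rintro ω ⟨hi, hi'⟩ ⟨hj, hj'⟩
    rcases lt_or_gt_of_ne hij with h | h
    · exact hi' j h hj
    · exact hj' i h hi
  -- Here `q` is the probability of never returning. The last-visit events are disjoint, so `∑
  -- pⁿ(x,x) q ≤ 1`.
  have hq : q = 0 := by
    by_contra hq
    have h1 : ∑' n, stepProb Q.jumpPMF x n x * q ≤ 1 :=
      calc _ ≤ ∑' n, Q.jumpChainLaw x (L n) := ENNReal.tsum_le_tsum hlow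
        _ = Q.jumpChainLaw x (⋃ n, L n) := (measure_iUnion hdisj hL).symm
        _ ≤ 1 := prob_le_one
    rw [ENNReal.tsum_mul_right, h, ENNReal.top_mul hq] at h1
    simp at h1
  have hnull : ∀ n, ∀ᵐ ω ∂Q.jumpChainLaw x, ω ∉ L n := fun n => by
    rw [ae_iff]
    simp only [not_not, Set.ofPred_mem_eq]
    refine le_antisymm ?_ zero_le
    have hub : ∀ k, Q.jumpChainLaw x (L n) ≤ Q.avoidProb x k x := fun k =>
      calc Q.jumpChainLaw x (L n)
          ≤ Q.jumpChainLaw x {ω | ω n = x ∧ ∀ m, n < m → m ≤ n + k → ω m ≠ x} :=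
            measure_mono fun ω hω => ⟨hω.1, fun m h1 _ => hω.2 m h1⟩
        _ ≤ _ := by
            rw [jumpChainLaw_lastVisit_le]
            exact mul_le_of_le_one_left' (stepProb_le_one _ _ _ _)
    exact (le_iInf hub).trans hq.le
  filter_upwards [ae_all_iff.mpr hnull, Q.ae_jumpChainLaw_zero x] with ω hω h0
  classical
  rw [Filter.frequently_atTop]
  by_contra! hN
  obtain ⟨N, hN⟩ := hN
  -- Finitely many visits, with at least the one at time `0`, would leave a last one.
  have hlast := Nat.findGreatest_spec (P := fun m => ω m = x) (Nat.zero_le N) h0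
  refine hω _ ⟨hlast, fun m hm hmx => ?_⟩
  rcases le_or_gt N m with h | h
  · exact hN m h hmx
  · exact Nat.findGreatest_is_greatest hm h.le hmx

end JumpRates

end JumpChain

/-! ### Independent exponential clocks. -/

section Exponential

lemma expMeasure_one_Iic (t : ℝ) (ht : 0 ≤ t) :
    expMeasure 1 (Set.Iic t) = ENNReal.ofReal (1 - Real.exp (-t)) := by
  rw [← ofReal_cdf, cdf_expMeasure_eq one_pos, if_pos ht, one_mul]

lemma ae_pos_infinitePi_expMeasure :
    ∀ᵐ e ∂Measure.infinitePi (fun _ : ℕ => expMeasure 1), ∀ n, 0 < e n := by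
  rw [ae_all_iff]
  intro n
  have h : ∀ᵐ t ∂expMeasure 1, 0 < t := by
    rw [ae_iff]
    have : {t : ℝ | ¬ 0 < t} = Set.Iic 0 := by ext; simp
    rw [this, expMeasure_one_Iic 0 le_rfl]
    simp
  exact (measurePreserving_eval_infinitePi (fun _ : ℕ => expMeasure 1) n).quasiMeasurePreserving.ae h

/-- The sum of independent exponential variables along an infinite set of indices is infinite. -/
lemma ae_tsum_indicator_eq_top {S : Set ℕ} (hS : S.Infinite) :
    ∀ᵐ e ∂Measure.infinitePi (fun _ : ℕ => expMeasure 1),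
      ∑' n, S.indicator (fun n => ENNReal.ofReal (e n)) n = ⊤ := by
  classical
  set P := Measure.infinitePi (fun _ : ℕ => expMeasure 1)
  -- By the second Borel–Cantelli lemma infinitely many clocks indexed by `S` exceed `1`, which
  -- prevents convergence of the sum.
  set A : ℕ → Set ℝ := fun n => if n ∈ S then Set.Ioi 1 else ∅
  set s : ℕ → Set (ℕ → ℝ) := fun n => (fun e => e n) ⁻¹' A n
  have hA : ∀ n, MeasurableSet (A n) := fun n => by
    simp only [A]; split_ifs
    · exact measurableSet_Ioi
    · exact MeasurableSet.empty
  have hs : ∀ n, MeasurableSet (s n) := fun n => measurable_pi_apply n (hA n)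
  have hPs : ∀ n, P (s n) = expMeasure 1 (A n) := fun n =>
    (measurePreserving_eval_infinitePi (fun _ : ℕ => expMeasure 1) n).measure_preimage
      (hA n).nullMeasurableSet
  have hind : iIndepSet s P := by
    rw [iIndepSet_iff_meas_biInter hs]
    intro t
    have : ⋂ i ∈ t, s i = Set.pi t A := by ext; simp [s, Set.mem_pi]
    rw [this, Measure.infinitePi_pi _ fun i _ => hA i]
    exact Finset.prod_congr rfl fun i _ => (hPs i).symm
  have htail : expMeasure 1 (Set.Ioi 1) ≠ 0 := by
    intro h
    have h1 : expMeasure 1 (Set.Iic 1) = 1 := by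
      rw [← Set.compl_Ioi, prob_compl_eq_one_iff measurableSet_Ioi]
      exact h
    rw [expMeasure_one_Iic 1 zero_le_one, ENNReal.ofReal_eq_one] at h1
    linarith [Real.exp_pos (-1)]
  have htsum : ∑' n, P (s n) = ⊤ := by
    have : ∀ n, P (s n) = S.indicator (fun _ => expMeasure 1 (Set.Ioi 1)) n := fun n => by
      rw [hPs]; by_cases hn : n ∈ S <;> simp [A, hn]
    simp_rw [this]
    rw [← tsum_subtype]
    have := hS.to_subtype
    exact ENNReal.tsum_const_eq_top_of_ne_zero htail
  have hlim := measure_limsup_eq_one hs hind htsum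
  have hae : ∀ᵐ e ∂P, e ∈ Filter.limsup s Filter.atTop :=
    (prob_compl_eq_zero_iff (MeasurableSet.measurableSet_limsup hs)).mpr hlim
  filter_upwards [hae] with e he
  rw [Filter.mem_limsup_iff_frequently_mem] at he
  by_contra htop
  have h0 := (ENNReal.tendsto_atTop_zero_of_tsum_ne_top htop).eventually_lt_const one_pos
  obtain ⟨n, hn, hn'⟩ := (he.and_eventually h0).exists
  by_cases hS : n ∈ S
  · simp only [s, A, hS, if_true, Set.mem_preimage, Set.mem_Ioi] at hn
    rw [Set.indicator_of_mem hS, ENNReal.ofReal_lt_one] at hn'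
    exact absurd hn hn'.not_gt
  · simp [s, A, hS] at hn

end Exponential

/-! ### Passage between continuous time and the jump chain. -/

section Recurrence

namespace JumpRates

variable {E : Type*} (Q : JumpRates E) {ω : (ℕ → E) × (ℕ → ℝ)} {x : E}

lemma jumpTime_mono : Monotone (Q.jumpTime ω) := fun _ _ h =>
  Finset.sum_le_sum_of_subset (Finset.range_mono h)

lemma holdingTime_ne_top (hQ : ∀ x, Q.holdingRate x ≠ 0) (n : ℕ) : Q.holdingTime ω n ≠ ⊤ :=
  ENNReal.div_ne_top ENNReal.ofReal_ne_top (by simpa using hQ _)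

lemma jumpTime_ne_top (hQ : ∀ x, Q.holdingRate x ≠ 0) (n : ℕ) : Q.jumpTime ω n ≠ ⊤ :=
  ENNReal.sum_ne_top.mpr fun k _ => Q.holdingTime_ne_top hQ k

lemma frequently_eq_of_not_bddAbove (hQ : ∀ x, Q.holdingRate x ≠ 0)
    (h : ¬ BddAbove {t : ℝ≥0 | Q.process t ω = some x}) : ∃ᶠ n in Filter.atTop, ω.1 n = x := by
  contrapose! h
  rw [Filter.eventually_atTop] at h
  obtain ⟨N, hN⟩ := h
  refine ⟨(Q.jumpTime ω N).toNNReal, fun t ht => ?_⟩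
  rw [Set.mem_ofPred_eq, process] at ht
  split_ifs at ht with hex
  rw [Option.some_inj] at ht
  have hlt : Nat.find hex < N := by
    by_contra! hle
    exact hN _ hle ht
  have h1 := (Nat.find_spec hex).le.trans (Q.jumpTime_mono (Nat.succ_le_of_lt hlt))
  rw [← ENNReal.coe_le_coe, ENNReal.coe_toNNReal (Q.jumpTime_ne_top hQ N)]
  exact h1

lemma process_jumpTime (hQ : ∀ x, Q.holdingRate x ≠ 0) (hω : ∀ n, 0 < ω.2 n) (n : ℕ) :
    Q.process (Q.jumpTime ω n).toNNReal ω = some (ω.1 n) := by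
  have hlt : ((Q.jumpTime ω n).toNNReal : ℝ≥0∞) < Q.jumpTime ω (n + 1) := by
    rw [ENNReal.coe_toNNReal (Q.jumpTime_ne_top hQ n)]
    simp only [jumpTime, Finset.sum_range_succ]
    refine ENNReal.lt_add_right (Q.jumpTime_ne_top hQ n) (ENNReal.div_pos ?_ ENNReal.coe_ne_top).ne'
    simpa using hω n
  have hex : ∃ n', ((Q.jumpTime ω n).toNNReal : ℝ≥0∞) < Q.jumpTime ω (n' + 1) := ⟨n, hlt⟩
  rw [process, dif_pos hex]
  refine congrArg (fun k => some (ω.1 k)) ((Nat.find_eq_iff hex).mpr ?_)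
  refine ⟨hlt, fun m hm => ?_⟩
  rw [ENNReal.coe_toNNReal (Q.jumpTime_ne_top hQ n), not_lt]
  exact Q.jumpTime_mono hm

/-- If visits to `x` stopped by time `B`, every jump time would be at most `B`; but the time spent
at `x` alone is infinite. This also rules out explosion. -/
lemma not_bddAbove_of_tsum_eq_top (hQ : ∀ x, Q.holdingRate x ≠ 0) (hω : ∀ n, 0 < ω.2 n)
    (hx : ∃ᶠ n in Filter.atTop, ω.1 n = x)
    (hsum : ∑' n, Set.indicator {n | ω.1 n = x} (fun n => ENNReal.ofReal (ω.2 n)) n = ⊤) :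
    ¬ BddAbove {t : ℝ≥0 | Q.process t ω = some x} := by
  rintro ⟨B, hB⟩
  have hle : ∀ n, Q.jumpTime ω n ≤ B := fun n => by
    obtain ⟨m, hnm, hm⟩ := (Filter.frequently_atTop.mp hx) n
    have h1 : (Q.jumpTime ω m).toNNReal ≤ B :=
      hB (show Q.process _ ω = some x by rw [Q.process_jumpTime hQ hω, hm])
    rw [← ENNReal.coe_le_coe, ENNReal.coe_toNNReal (Q.jumpTime_ne_top hQ m)] at h1
    exact (Q.jumpTime_mono hnm).trans h1
  have h1 : ∑' n, Q.holdingTime ω n ≤ B := by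
    rw [ENNReal.tsum_eq_iSup_nat]
    exact iSup_le hle
  have h2 : ∑' n, Set.indicator {n | ω.1 n = x} (fun n => ENNReal.ofReal (ω.2 n)) n *
      (Q.holdingRate x : ℝ≥0∞)⁻¹ ≤ ∑' n, Q.holdingTime ω n := by
    refine ENNReal.tsum_le_tsum fun n => ?_
    by_cases hn : ω.1 n = x
    · rw [Set.indicator_of_mem (by exact hn), holdingTime, hn, div_eq_mul_inv]
    · rw [Set.indicator_of_notMem (by exact hn), zero_mul]
      exact zero_le
  rw [ENNReal.tsum_mul_right, hsum, ENNReal.top_mul (by simp)] at h2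
  exact absurd (h2.trans h1) (by simp)

variable [MeasurableSpace E] [DiscreteMeasurableSpace E]

lemma ae_frequently_of_recurrent (hQ : ∀ x, Q.holdingRate x ≠ 0) (h : Q.Recurrent) (x : E) :
    ∀ᵐ y ∂Q.jumpChainLaw x, ∃ᶠ n in Filter.atTop, y n = x := by
  have h1 : ∀ᵐ ω ∂(Q.jumpChainLaw x).prod (Measure.infinitePi fun _ : ℕ => expMeasure 1),
      ∃ᶠ n in Filter.atTop, ω.1 n = x := by
    filter_upwards [h x] with ω hω using Q.frequently_eq_of_not_bddAbove hQ hω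
  filter_upwards [Measure.ae_ae_of_ae_prod h1] with y hy
  obtain ⟨_, h⟩ := hy.exists
  exact h

lemma recurrent_of_ae_frequently (hQ : ∀ x, Q.holdingRate x ≠ 0)
    (h : ∀ x, ∀ᵐ y ∂Q.jumpChainLaw x, ∃ᶠ n in Filter.atTop, y n = x) : Q.Recurrent := by
  intro x
  have h1 : ∀ᵐ ω ∂Q.law x, ∃ᶠ n in Filter.atTop, ω.1 n = x :=
    Measure.quasiMeasurePreserving_fst.ae (h x)
  have h2 : ∀ᵐ ω ∂Q.law x, ∀ n, 0 < ω.2 n :=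
    Measure.quasiMeasurePreserving_snd.ae ae_pos_infinitePi_expMeasure
  have h3 : ∀ᵐ ω ∂Q.law x,
      ∑' n, Set.indicator {n | ω.1 n = x} (fun n => ENNReal.ofReal (ω.2 n)) n = ⊤ := by
    have hmeas : Measurable fun ω : (ℕ → E) × (ℕ → ℝ) =>
        ∑' n, Set.indicator {n | ω.1 n = x} (fun n => ENNReal.ofReal (ω.2 n)) n := by
      refine Measurable.tsum fun n => ?_
      have hset : MeasurableSet {ω : (ℕ → E) × (ℕ → ℝ) | ω.1 n = x} :=
        (measurableSet_apply_mem n {x}).preimage measurable_fst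
      exact Measurable.indicator (f := fun ω : (ℕ → E) × (ℕ → ℝ) => ENNReal.ofReal (ω.2 n))
        (by fun_prop) hset
    -- Once the jump chain is frozen, the visit times form a deterministic infinite set, independent
    -- of the clocks.
    refine (Measure.ae_prod_iff_ae_ae (hmeas (measurableSet_singleton ⊤))).mpr ?_
    filter_upwards [h x] with y hy
    exact ae_tsum_indicator_eq_top (Nat.frequently_atTop_iff_infinite.mp hy)
  filter_upwards [h1, h2, h3] with ω a b c using Q.not_bddAbove_of_tsum_eq_top hQ b a c

lemma recurrent_of_subsingleton [Subsingleton E] : Q.Recurrent := by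
  intro x
  have h2 : ∀ᵐ ω ∂Q.law x, ∀ n, 0 < ω.2 n :=
    Measure.quasiMeasurePreserving_snd.ae ae_pos_infinitePi_expMeasure
  filter_upwards [h2] with ω hω
  have h0 : Q.holdingRate (ω.1 0) = 0 := by
    rw [holdingRate]
    exact (tsum_congr fun y => by rw [Subsingleton.elim y (ω.1 0), Q.rate_self]).trans tsum_zero
  have h1 : Q.jumpTime ω 1 = ⊤ := by
    rw [jumpTime, Finset.sum_range_one, holdingTime, h0, ENNReal.coe_zero, ENNReal.div_zero]
    simpa using hω 0
  have : {t : ℝ≥0 | Q.process t ω = some x} = Set.univ := by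
    refine Set.eq_univ_of_forall fun t => ?_
    have hex : ∃ n, (t : ℝ≥0∞) < Q.jumpTime ω (n + 1) := ⟨0, by rw [zero_add, h1]; simp⟩
    rw [Set.mem_ofPred_eq, process, dif_pos hex]
    congr 1
    exact Subsingleton.elim _ _
  rw [this]
  exact not_bddAbove_univ

end JumpRates

end Recurrence

/-! ### Rates, stationary measure and conclusion. -/

namespace JumpRates

variable {E : Type*} (Q : JumpRates E) {μ : E → ℝ≥0}

lemma toReal_jumpPMF {x : E} (hx : Q.holdingRate x ≠ 0) (y : E) :
    Q.holdingRate x * (Q.jumpPMF x y).toReal = (Q.rate x y : ℝ) := by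
  have hsum : ∑' y, (Q.rate x y : ℝ≥0∞) = Q.holdingRate x :=
    (ENNReal.coe_tsum (Q.summable_rate x)).symm
  have h : ∑' y, (Q.rate x y : ℝ≥0∞) ≠ 0 := by rw [hsum]; simpa using hx
  have hx' : (Q.holdingRate x : ℝ) ≠ 0 := by simpa using hx
  rw [jumpPMF, dif_neg h, PMF.normalize_apply, hsum]
  simp only [ENNReal.toReal_mul, ENNReal.toReal_inv, ENNReal.coe_toReal]
  field_simp

lemma holdingRate_ne_zero_or_subsingleton (hirr : Q.Irreducible) :
    (∀ x, Q.holdingRate x ≠ 0) ∨ Subsingleton E := by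
  by_cases h : ∀ x, Q.holdingRate x ≠ 0
  · exact Or.inl h
  · push Not at h
    obtain ⟨x, hx⟩ := h
    have hr : ∀ y, Q.rate x y = 0 := fun y =>
      le_antisymm (((Q.summable_rate x).le_tsum y fun _ _ => zero_le).trans hx.le) zero_le
    have hall : ∀ y, y = x := fun y => by
      rcases (hirr x y).cases_head with h | ⟨b, hb, _⟩
      · exact h.symm
      · rw [hr] at hb
        exact absurd hb (lt_irrefl _)
    exact Or.inr ⟨fun a b => (hall a).trans (hall b).symm⟩

variable {Q}

lemma IsStationary.pos (h : Q.IsStationary μ) (hirr : Q.Irreducible) (x : E) : 0 < μ x := by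
  obtain ⟨z, hz⟩ := Function.ne_iff.mp h.ne_zero
  induction hirr z x with
  | refl => exact pos_iff_ne_zero.mpr hz
  | @tail x y _ hxy ih =>
    have h1 : μ x * Q.rate x y ≤ μ y * Q.holdingRate y :=
      le_hasSum (h.balance y) x fun _ _ => zero_le
    exact pos_of_mul_pos_left ((mul_pos ih hxy).trans_le h1) zero_le

/-- Stationarity says that the reversed rates have the same total at `x`. Hence both jump chains
share the weight `M = μ λ`. -/
lemma holdingRate_symmetrization (h : Q.IsStationary μ) (hμ : ∀ x, 0 < μ x) (x : E) :
    (Q.symmetrization μ h).holdingRate x = Q.holdingRate x := by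
  have h1 : HasSum ((Q.adjoint μ h).rate x) (μ x * Q.holdingRate x / μ x) :=
    (h.balance x).div_const (μ x)
  rw [mul_div_cancel_left₀ _ (hμ x).ne'] at h1
  have h2 := ((Q.summable_rate x).hasSum.add h1).div_const 2
  rw [← holdingRate, add_self_div_two] at h2
  exact h2.tsum_eq

lemma conductance_adjoint (h : Q.IsStationary μ) (hμ : ∀ x, 0 < μ x) (x y : E) :
    (Q.adjoint μ h).conductance μ x y = Q.conductance μ y x := by
  have := (NNReal.coe_pos.mpr (hμ x)).ne'
  simp only [conductance, adjoint, NNReal.coe_div, NNReal.coe_mul]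
  field_simp

end JumpRates

theorem lemma4p3 {E : Type*} [Countable E] [MeasurableSpace E] [DiscreteMeasurableSpace E]
    (Q : JumpRates E) (hirr : Q.Irreducible)
    (μ : E → ℝ≥0) (hμ : Q.IsStationary μ)
    (hrec : (Q.symmetrization μ hμ).Recurrent)
    (hsum : Summable (fun e : Q.edges μ hμ =>
      Q.asymmConductance μ hμ e.1.1 e.1.2 ^ 2 / Q.symmConductance μ hμ e.1.1 e.1.2)) :
    Q.Recurrent := by
  rcases Q.holdingRate_ne_zero_or_subsingleton hirr with hQ | hE
  swap
  · exact Q.recurrent_of_subsingleton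
  have hpos := hμ.pos hirr
  have hadj := JumpRates.conductance_adjoint hμ hpos
  have hQs : ∀ x, (Q.symmetrization μ hμ).holdingRate x ≠ 0 := fun x => by
    rw [JumpRates.holdingRate_symmetrization hμ hpos]; exact hQ x
  have hc0 : ∀ x y, 0 ≤ Q.conductance μ x y := fun x y => by
    unfold JumpRates.conductance; positivity
  have hs0 : ∀ x y, 0 ≤ Q.symmConductance μ hμ x y := fun x y => by
    rw [JumpRates.symmConductance, hadj]; linarith [hc0 x y, hc0 y x]
  refine Q.recurrent_of_ae_frequently hQ fun z => Q.ae_frequently_of_tsum_stepProb_eq_top ?_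
  refine tsum_stepProb_eq_top_of_symm (M := fun x => μ x * Q.holdingRate x) z
    (c := Q.conductance μ) (a := Q.symmConductance μ hμ) (b := Q.asymmConductance μ hμ)
    (q := (Q.symmetrization μ hμ).jumpPMF) (fun x => ?_) (fun x y => ?_) (fun y => ?_)
    (fun x y => ?_) (fun x y => ?_) (fun x y => ?_) (fun x => ?_) ?_
    ((Q.symmetrization μ hμ).tsum_stepProb_eq_top
      ((Q.symmetrization μ hμ).ae_frequently_of_recurrent hQs hrec z))
  · exact_mod_cast mul_pos (hpos x) (pos_iff_ne_zero.mpr (hQ x))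
  · rw [mul_assoc, Q.toReal_jumpPMF (hQ x)]; rfl
  · simpa only [JumpRates.conductance, NNReal.coe_mul] using
      NNReal.hasSum_coe.mpr (hμ.balance y)
  · rw [JumpRates.symmConductance, hadj]; ring
  · rw [JumpRates.asymmConductance, hadj]; ring
  · rw [mul_assoc, ← JumpRates.holdingRate_symmetrization hμ hpos,
      (Q.symmetrization μ hμ).toReal_jumpPMF (hQs x)]
    simp only [JumpRates.symmConductance, JumpRates.conductance, JumpRates.symmetrization,
      NNReal.coe_div, NNReal.coe_add, NNReal.coe_ofNat]
    ring
  · refine (hirr z x).lift id fun x y hxy => ?_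
    have : 0 < Q.conductance μ x y := by exact_mod_cast mul_pos (hpos x) hxy
    change 0 < Q.symmConductance μ hμ x y
    rw [JumpRates.symmConductance, hadj]
    linarith [hc0 y x]
  · have h := (summable_subtype_iff_indicator (f := fun e : E × E =>
      Q.asymmConductance μ hμ e.1 e.2 ^ 2 / Q.symmConductance μ hμ e.1 e.2)).mp hsum
    refine h.congr fun e => ?_
    by_cases he : e ∈ Q.edges μ hμ
    · rw [Set.indicator_of_mem he]
    -- Off the edge set the quotient is a division by zero, with value `0`, so summing over all
    -- pairs adds nothing.
    · have : Q.symmConductance μ hμ e.1 e.2 = 0 := le_antisymm (not_lt.mp he) (hs0 _ _)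
      rw [Set.indicator_of_notMem he, this, div_zero]
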